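/- Define polynomials $a_i\in\mathbb{Z}[c]$ by $a_1=c$ and $a_{i+1}=a_i^2+c$ for $i\ge 1$, so that $a_i(c_0)=f_{c_0}^{i}(0)$ is the $i$-th iterate of the critical point $0$ under $f_{c_0}(z)=z^2+c_0$. For integers $m\ge 2$ and $n\ge 1$, let $\mu$ be the Möbius function and let $$G_{m,n}(c)=\prod_{k\mid n}\bigl(a_{m+k-1}+a_{m-1}\bigr)^{\mu(n/k)}\cdot\begin{cases}\prod_{k\mid n}a_k^{-\mu(n/k)} & \text{if } n\mid m-1,\\ 1 & \text{if } n\nmid m-1,\end{cases}$$ be the quadratic Misiurewicz polynomial of type $(m,n)$. Let $c_1,\dots,c_r\in\mathbb{C}$ be all the roots of $G_{m,n}$ (with multiplicity), and let $\lambda_{m,n}(c_j)=(f_{c_j}^{n})'(a_m(c_j))$ be the multiplier of the periodic cycle $\{a_m(c_j),\dots,a_{m+n-1}(c_j)\}$ of $f_{c_j}$. The multiplier polynomial is $$P_{m,n}(x)=\prod_{j=1}^{r}\bigl(x-\lambda_{m,n}(c_j)\bigr).$$ For a prime $p$, with $v_p$ the $p$-adic valuation ($v_p(0)=\infty$), a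 monic polynomial $P(x)=x^i+A_{i-1}x^{i-1}+\dots+A_1x+A_0\in\mathbb{Z}[x]$ of degree $i\ge 1$ is called $p$-special if $v_p(A_{i-1})>v_p(2)$ and $v_p(A_j)>v_p(A_{i-1})$ for all $j=0,1,\dots,i-2$. **Theorem 7.2.** For every integer $m\ge 2$, the polynomials $P_{m,1}$ and $P_{m,2}$ have integer coefficients, and both are $2$-special. -/

import Mathlib

open Polynomial

noncomputable section

/-- The critical orbit of `z ↦ z ^ 2 + c`, as polynomials in the parameter `c`:
`a₁ = c` and `a_{i+1} = a_i ^ 2 + c` (so `a_i` is the `i`-th iterate of the critical point `0`). -/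
def critOrbit : ℕ → ℂ[X]
  | 0 => 0
  | i + 1 => critOrbit i ^ 2 + X

/-- The Möbius product defining the quadratic Misiurewicz polynomial `G_{m,n}` (the square root of
unity `ζ ≠ 1` is `-1`, so `a_{m+k-1} - ζ a_{m-1} = a_{m+k-1} + a_{m-1}`), computed in the field of
rational functions of `c`. -/
def misiurewiczRatFunc (m n : ℕ) : RatFunc ℂ :=
  (∏ k ∈ n.divisors,
      algebraMap ℂ[X] (RatFunc ℂ) (critOrbit (m + k - 1) + critOrbit (m - 1)) ^
        ArithmeticFunction.moebius (n / k)) *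
    if n ∣ m - 1 then
      ∏ k ∈ n.divisors,
        algebraMap ℂ[X] (RatFunc ℂ) (critOrbit k) ^ (-ArithmeticFunction.moebius (n / k))
    else 1

/-- The Misiurewicz polynomial `G_{m,n}`. The rational function above is a polynomial, so that
it is equal to its own numerator in lowest terms (normalised with monic denominator). -/
def misiurewiczPoly (m n : ℕ) : ℂ[X] :=
  (misiurewiczRatFunc m n).num

/-- The quadratic polynomial map `f_c(z) = z ^ 2 + c`. -/
def quadMap (c : ℂ) (z : ℂ) : ℂ := z ^ 2 + c

/-- The multiplier `(f_c^n)'(a_m(c))` of the cycle `{a_m(c), …, a_{m+n-1}(c)}` into which the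
critical orbit of `f_c` falls, when `c` is a root of `G_{m,n}`; here `a_m(c) = f_c^m(0)`. -/
def cycleMultiplier (m n : ℕ) (c : ℂ) : ℂ :=
  deriv (quadMap c)^[n] ((quadMap c)^[m] 0)

/-- The multiplier polynomial `P_{m,n} = ∏ (x - λ_{m,n}(c_j))`, the product being over all the
complex roots `c_j` of `G_{m,n}` (a multiset). -/
def multiplierPoly (m n : ℕ) : ℂ[X] :=
  ((misiurewiczPoly m n).roots.map fun c => X - C (cycleMultiplier m n c)).prod

/-- `P = x ^ i + A_{i-1} x ^ (i-1) + ⋯ + A₀ ∈ ℤ[x]`, monic of degree `i ≥ 1`, is `p`-special if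
`v_p(A_{i-1}) > v_p(2)` and `v_p(A_j) > v_p(A_{i-1})` for `0 ≤ j ≤ i - 2`. The `p`-adic valuation
on `ℤ` is `emultiplicity`, with value `⊤` at `0`. -/
def IsPSpecial (p : ℕ) (P : ℤ[X]) : Prop :=
  P.Monic ∧ 1 ≤ P.natDegree ∧
    emultiplicity (p : ℤ) 2 < emultiplicity (p : ℤ) (P.coeff (P.natDegree - 1)) ∧
    ∀ j : ℕ, j < P.natDegree - 1 →
      emultiplicity (p : ℤ) (P.coeff (P.natDegree - 1)) < emultiplicity (p : ℤ) (P.coeff j)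

end

/-! At a root of `G_{m,n}` with `n ≤ 2`, the parameter `c` is a polynomial in the multiplier `λ`.
For `n = 1` the fixed point `y = a_m` gives `λ = 2y` and `c = y - y²`. For `n = 2` the points of the
cycle have sum `-1` and product `c + 1`, so `λ = 4(c + 1)`. Hence each `a_i` becomes a polynomial in
`λ`. Clearing powers of 2 turns the equation defining `G` (up to a linear factor whose root has `λ =
0`) into a monic integer polynomial of the right degree that annihilates `λ`. Since `c` is recovered
from `λ`, `prod_X_sub_C_eval_eq` identifies it with the product over the roots; simplicity of the
roots is never needed.

The coefficients are controlled through `IsSpecialForm`, which is 2-special once `2 ≤ s`. The orbit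
recursion is a square (times `X` for `n = 1`) plus a perturbation. Squaring raises `s` by one
(`IsSpecialForm.sq`), while the perturbation is divisible by a power of 2 whose exponent grows
exponentially, so it is absorbed in the remainder (`IsSpecialForm.add_C_mul`). -/

/-- The monic integer polynomials `X ^ (e + 1) - 2 ^ s * X ^ e + ⋯` whose remaining coefficients
are all divisible by `2 ^ (s + 1)`. -/
def IsSpecialForm (s e : ℕ) (P : ℤ[X]) : Prop :=
  ∃ R : ℤ[X], R.degree < e ∧ P = X ^ (e + 1) - C (2 ^ s) * X ^ e + C (2 ^ (s + 1)) * R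

/-! ### Stability of the special form. -/

namespace IsSpecialForm

variable {s e : ℕ} {P Q : ℤ[X]}

lemma degree_tail_lt {R : ℤ[X]} (hR : R.degree < e) :
    (-(C (2 ^ s) * X ^ e) + C (2 ^ (s + 1)) * R).degree < ((e + 1 : ℕ) : WithBot ℕ) := by
  have he : ((e : ℕ) : WithBot ℕ) < ((e + 1 : ℕ) : WithBot ℕ) := by
    exact_mod_cast Nat.lt_succ_self e
  refine lt_of_le_of_lt (degree_add_le _ _) (max_lt ?_ ?_)
  · rw [degree_neg]
    exact (degree_C_mul_X_pow_le _ _).trans_lt he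
  · refine lt_of_le_of_lt ?_ (hR.trans he)
    rw [← smul_eq_C_mul]
    exact degree_smul_le _ _

lemma monic (h : IsSpecialForm s e P) : P.Monic := by
  obtain ⟨R, hR, rfl⟩ := h
  rw [sub_eq_add_neg, add_assoc]
  exact monic_X_pow_add (degree_tail_lt hR)

lemma natDegree_eq (h : IsSpecialForm s e P) : P.natDegree = e + 1 := by
  obtain ⟨R, hR, rfl⟩ := h
  rw [sub_eq_add_neg, add_assoc]
  apply natDegree_eq_of_degree_eq_some
  rw [degree_add_eq_left_of_degree_lt, degree_X_pow]
  rw [degree_X_pow]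
  exact degree_tail_lt hR

lemma isPSpecial (hs : 2 ≤ s) (h : IsSpecialForm s e P) : IsPSpecial 2 P := by
  have hd := h.natDegree_eq
  have hmon := h.monic
  obtain ⟨R, hR, rfl⟩ := h
  have hsub : (X ^ (e + 1) - C (2 ^ s) * X ^ e + C (2 ^ (s + 1)) * R : ℤ[X]).coeff e
      = -2 ^ s := by
    rw [coeff_add, coeff_sub, coeff_C_mul, coeff_C_mul, coeff_X_pow, coeff_X_pow,
      coeff_eq_zero_of_degree_lt hR]
    simp
  have hv : emultiplicity (2 : ℤ) (-2 ^ s) = s := by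
    rw [emultiplicity_neg, emultiplicity_pow_self (by norm_num)
      (Int.prime_two.not_isUnit)]
  refine ⟨hmon, by omega, ?_, ?_⟩
  · rw [hd, Nat.add_sub_cancel, hsub]
    have h1 : emultiplicity (2 : ℤ) 2 = 1 := by
      simpa using emultiplicity_pow_self (p := (2 : ℤ)) (by norm_num)
        (Int.prime_two.not_isUnit) 1
    push_cast
    rw [hv, h1]
    exact_mod_cast hs
  · intro j hj
    rw [hd, Nat.add_sub_cancel] at *
    rw [hsub]
    push_cast
    rw [hv]
    refine lt_of_lt_of_le (b := ((s + 1 : ℕ) : ℕ∞)) (by exact_mod_cast Nat.lt_succ_self s) ?_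
    apply le_emultiplicity_of_pow_dvd
    rw [coeff_add, coeff_sub, coeff_C_mul, coeff_C_mul, coeff_X_pow, coeff_X_pow,
      if_neg (by omega), if_neg (by omega)]
    simp

lemma add_C_mul (h : IsSpecialForm s e P) (hQ : Q.degree < e) {a : ℤ} (ha : 2 ^ (s + 1) ∣ a) :
    IsSpecialForm s e (P + C a * Q) := by
  obtain ⟨R, hR, rfl⟩ := h
  obtain ⟨b, rfl⟩ := ha
  refine ⟨R + C b * Q, ?_, ?_⟩
  · refine lt_of_le_of_lt (degree_add_le _ _) (max_lt hR ?_)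
    rw [← smul_eq_C_mul]
    exact (degree_smul_le _ _).trans_lt hQ
  · rw [C_mul]; ring

lemma X_mul (h : IsSpecialForm s e P) : IsSpecialForm s (e + 1) (X * P) := by
  obtain ⟨R, hR, rfl⟩ := h
  refine ⟨X * R, ?_, by ring⟩
  rw [mul_comm, degree_mul_X]
  push_cast
  exact WithBot.add_lt_add_right (by simp) hR

lemma of_X_mul (h : IsSpecialForm s (e + 2) (X * P)) : IsSpecialForm s (e + 1) P := by
  obtain ⟨R, hR, hP⟩ := h
  -- `X * P` and both leading terms have no constant term, so neither has the remainder.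
  have h0 : R.coeff 0 = 0 := by
    have := congrArg (fun p : ℤ[X] => p.coeff 0) hP
    rw [coeff_add, coeff_sub, coeff_C_mul, coeff_C_mul, coeff_X_pow, coeff_X_pow] at this
    simpa using this
  obtain ⟨R', rfl⟩ := X_dvd_iff.2 h0
  refine ⟨R', ?_, ?_⟩
  · rw [mul_comm, degree_mul_X] at hR
    push_cast at hR ⊢
    by_contra hcon
    push Not at hcon
    refine absurd hR (not_lt.2 ?_)
    calc ((e : WithBot ℕ) + 2) = e + 1 + 1 := by rw [add_assoc, one_add_one_eq_two]
      _ ≤ _ := by gcongr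
  · apply mul_left_cancel₀ (X_ne_zero (R := ℤ))
    rw [hP]; ring

/-- The cross term doubles `2 ^ s`. The term `2 ^ (2 * s) * X ^ (2 * e)` falls into the remainder
because `s + 2 ≤ 2 * s`; this is where `2 ≤ s` enters. -/
lemma sq (hs : 2 ≤ s) (h : IsSpecialForm s e P) : IsSpecialForm (s + 1) (2 * e + 1) (P ^ 2) := by
  obtain ⟨R, hR, rfl⟩ := h
  obtain ⟨t, rfl⟩ := Nat.exists_eq_add_of_le' hs
  refine ⟨C (2 ^ t) * X ^ (2 * e) + (X ^ (e + 1) - C (2 ^ (t + 2)) * X ^ e) * R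
    + C (2 ^ (t + 2)) * R ^ 2, ?_, ?_⟩
  · by_cases hR0 : R = 0
    · subst hR0
      simp only [mul_zero, add_zero, ne_eq, OfNat.ofNat_ne_zero, not_false_eq_true, zero_pow]
      refine (degree_C_mul_X_pow_le _ _).trans_lt ?_
      exact_mod_cast Nat.lt_succ_self _
    · have hn : R.natDegree < e := (natDegree_lt_iff_degree_lt hR0).2 hR
      apply lt_of_le_of_lt degree_le_natDegree
      norm_cast
      refine Nat.lt_succ_of_le ?_
      refine (natDegree_add_le _ _).trans (max_le ((natDegree_add_le _ _).trans (max_le ?_ ?_)) ?_)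
      · exact natDegree_C_mul_X_pow_le _ _
      · refine natDegree_mul_le.trans ?_
        have : (X ^ (e + 1) - C (2 ^ (t + 2)) * X ^ e : ℤ[X]).natDegree ≤ e + 1 := by
          refine (natDegree_sub_le _ _).trans (max_le (natDegree_X_pow_le _) ?_)
          exact (natDegree_C_mul_X_pow_le _ _).trans (Nat.le_succ e)
        exact (add_le_add_left this _).trans (by omega)
      · refine (natDegree_C_mul_le _ _).trans ?_
        exact natDegree_pow_le.trans (by omega)
  · simp only [C_pow, C_ofNat]
    ring

end IsSpecialForm

/-! ### Recognising a product over roots, with multiplicity. -/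

/-- If the polynomial `u` has a left inverse `w` under composition modulo `∏ (X - c)`, then a monic
polynomial of the right degree annihilating `u` modulo `∏ (X - c)` is `∏ (X - u(c))`. -/
lemma prod_X_sub_C_eval_eq {K : Type*} [Field K] (u w : K[X]) (s : Multiset K) (Q : K[X])
    (hQ : Q.Monic) (hd : Q.natDegree = s.card)
    (hQu : (s.map fun c => X - C c).prod ∣ Q.comp u)
    (hw : (s.map fun c => X - C c).prod ∣ w.comp u - X) :
    (s.map fun c => X - C (u.eval c)).prod = Q := by
  induction s using Multiset.induction_on generalizing Q with
  | empty => simpa using (hQ.natDegree_eq_zero.1 (by simpa using hd)).symm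
  | cons c s ih =>
    rw [Multiset.map_cons, Multiset.prod_cons] at hQu hw ⊢
    have hroot : Q.IsRoot (u.eval c) := by
      have := dvd_iff_isRoot.1 ((dvd_mul_right _ _).trans hQu)
      rwa [IsRoot, eval_comp] at this
    obtain ⟨Q', rfl⟩ := dvd_iff_isRoot.2 hroot
    have hm : Q'.Monic := (monic_X_sub_C _).of_mul_monic_left hQ
    have hd' : Q'.natDegree = s.card := by
      rw [(monic_X_sub_C _).natDegree_mul hm, natDegree_X_sub_C, Multiset.card_cons] at hd
      omega
    -- After cancelling `X - c`, it remains to remove the factor `v = (u - u(c)) / (X - c)`, which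
    -- must be coprime to the other `X - b`.
    obtain ⟨v, hv⟩ := X_sub_C_dvd_sub_C_eval (p := u) (a := c)
    congr 1
    refine ih Q' hm hd' ?_ ((dvd_mul_left _ _).trans hw)
    rw [mul_comp, sub_comp, X_comp, C_comp, hv, mul_assoc] at hQu
    refine IsCoprime.dvd_of_dvd_mul_left ?_ ((mul_dvd_mul_iff_left (X_sub_C_ne_zero c)).1 hQu)
    refine Multiset.prod_induction (fun q => IsCoprime q v) _ (fun _ _ => IsCoprime.mul_left)
      isCoprime_one_left ?_
    intro q hq
    obtain ⟨b, hb, rfl⟩ := Multiset.mem_map.1 hq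
    -- If `v(b) = 0`, then `(X - c)(X - b)` divides both `w ∘ u - w(u(c))` and `w ∘ u - X`, hence
    -- their difference, of degree 1. This covers `b = c` as well.
    refine (irreducible_X_sub_C b).coprime_iff_not_dvd.2 fun hbv => ?_
    have h1 : (X - C c) * (X - C b) ∣ w.comp u - X :=
      (mul_dvd_mul_left _ (Multiset.dvd_prod hq)).trans hw
    have h2 : (X - C c) * (X - C b) ∣ w.comp u - C (w.eval (u.eval c)) := by
      refine (mul_dvd_mul_left _ hbv).trans ?_
      obtain ⟨r, hr⟩ := X_sub_C_dvd_sub_C_eval (p := w) (a := u.eval c)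
      refine ⟨r.comp u, ?_⟩
      rw [← hv]
      simpa using congrArg (fun p : K[X] => p.comp u) hr
    have h3 := dvd_sub h2 h1
    rw [sub_sub_sub_cancel_left] at h3
    have := natDegree_le_of_dvd h3 (X_sub_C_ne_zero _)
    rw [(monic_X_sub_C c).natDegree_mul (monic_X_sub_C b)] at this
    simp at this

/-! ### Critical orbit, multipliers and Misiurewicz polynomials for periods 1 and 2. -/

lemma critOrbit_succ (i : ℕ) : critOrbit (i + 1) = critOrbit i ^ 2 + X := rfl

lemma critOrbit_one : critOrbit 1 = X := by simp [critOrbit]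

lemma natDegree_critOrbit (i : ℕ) : (critOrbit (i + 1)).natDegree = 2 ^ i := by
  induction i with
  | zero => simp [critOrbit_one]
  | succ i ih =>
    rw [critOrbit_succ]
    by_cases hi : i = 0
    · subst hi; rw [critOrbit_one]; compute_degree!
    · rw [natDegree_add_eq_left_of_natDegree_lt, natDegree_pow, ih, pow_succ']
      rw [natDegree_pow, ih, natDegree_X]
      have := Nat.one_le_two_pow (n := i)
      omega

lemma monic_critOrbit (i : ℕ) : (critOrbit (i + 1)).Monic := by
  induction i with
  | zero => simp [critOrbit_one, monic_X]
  | succ i ih =>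
    rw [critOrbit_succ]
    refine (ih.pow 2).add_of_left ?_
    apply degree_lt_degree
    rw [natDegree_pow, natDegree_critOrbit, natDegree_X]
    have := Nat.one_le_two_pow (n := i)
    omega

lemma iterate_quadMap_zero (c : ℂ) (i : ℕ) : (quadMap c)^[i] 0 = (critOrbit i).eval c := by
  induction i with
  | zero => simp [critOrbit]
  | succ i ih => rw [Function.iterate_succ_apply', ih]; simp [critOrbit, quadMap]

lemma X_dvd_critOrbit (i : ℕ) : X ∣ critOrbit i := by
  induction i with
  | zero => simp [critOrbit]
  | succ i ih => exact dvd_add (ih.trans (dvd_pow_self _ two_ne_zero)) dvd_rfl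

lemma hasDerivAt_quadMap (c z : ℂ) : HasDerivAt (quadMap c) (2 * z) z := by
  have h := ((hasDerivAt_id z).pow 2).add_const c
  simp only [id, Nat.cast_ofNat, Nat.add_one_sub_one, pow_one, mul_one] at h
  exact h

lemma cycleMultiplier_one (m : ℕ) (c : ℂ) :
    cycleMultiplier m 1 c = 2 * (critOrbit m).eval c := by
  rw [cycleMultiplier, iterate_quadMap_zero, Function.iterate_one, (hasDerivAt_quadMap c _).deriv]

lemma cycleMultiplier_two (m : ℕ) (c : ℂ) :
    cycleMultiplier m 2 c = 4 * ((critOrbit m).eval c * (critOrbit (m + 1)).eval c) := by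
  rw [cycleMultiplier, iterate_quadMap_zero]
  have h := (hasDerivAt_quadMap c (quadMap c ((critOrbit m).eval c))).comp _
    (hasDerivAt_quadMap c ((critOrbit m).eval c))
  rw [show (quadMap c)^[2] = quadMap c ∘ quadMap c from rfl, h.deriv]
  simp only [quadMap, critOrbit_succ, eval_add, eval_pow, eval_X]
  ring

lemma misiurewiczPoly_one {m : ℕ} {G : ℂ[X]} (hG : critOrbit m + critOrbit (m - 1) = X * G) :
    misiurewiczPoly m 1 = G := by
  have hX : algebraMap ℂ[X] (RatFunc ℂ) X ≠ 0 := by simpa using RatFunc.X_ne_zero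
  have : misiurewiczRatFunc m 1 = algebraMap ℂ[X] (RatFunc ℂ) G := by
    simp only [misiurewiczRatFunc, Nat.divisors_one, Finset.prod_singleton, Nat.add_sub_cancel,
      hG, critOrbit_one, one_dvd, if_true, Nat.div_one, ArithmeticFunction.moebius_apply_one,
      zpow_one, zpow_neg, map_mul]
    field_simp
  rw [misiurewiczPoly, this, RatFunc.num_algebraMap]

/-- Since `a_{m+2} - a_{m+1} = a_{m+1}² - a_m²`. The first factor is the period 1 contribution,
which the Möbius product for `n = 2` cancels. -/
lemma critOrbit_add_critOrbit (m : ℕ) :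
    critOrbit (m + 2) + critOrbit m =
      (critOrbit (m + 1) + critOrbit m) * (critOrbit (m + 1) - critOrbit m + 1) := by
  rw [critOrbit_succ (m + 1)]
  linear_combination -critOrbit_succ m

lemma degree_critOrbit_lt (i : ℕ) : (critOrbit i).degree < (critOrbit (i + 1)).degree := by
  rcases i with _ | i
  · simp [critOrbit]
  · apply degree_lt_degree
    rw [natDegree_critOrbit, natDegree_critOrbit]
    exact Nat.pow_lt_pow_right one_lt_two i.lt_succ_self

lemma monic_critOrbit_add (i : ℕ) : (critOrbit (i + 1) + critOrbit i).Monic :=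
  (monic_critOrbit i).add_of_left (degree_critOrbit_lt i)

lemma natDegree_critOrbit_add (i : ℕ) : (critOrbit (i + 1) + critOrbit i).natDegree = 2 ^ i := by
  rw [natDegree_add_eq_left_of_degree_lt (degree_critOrbit_lt i), natDegree_critOrbit]

lemma degree_one_sub_critOrbit_lt (i : ℕ) :
    (1 - critOrbit (i + 1)).degree < (critOrbit (i + 2)).degree := by
  refine lt_of_le_of_lt (degree_sub_le _ _) (max_lt ?_ (degree_critOrbit_lt _))
  apply degree_lt_degree
  rw [natDegree_critOrbit, natDegree_one]
  positivity

lemma monic_critOrbit_sub (i : ℕ) : (critOrbit (i + 2) - critOrbit (i + 1) + 1).Monic := by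
  rw [sub_add_eq_add_sub, add_sub_assoc]
  exact (monic_critOrbit _).add_of_left (degree_one_sub_critOrbit_lt i)

lemma natDegree_critOrbit_sub (i : ℕ) :
    (critOrbit (i + 2) - critOrbit (i + 1) + 1).natDegree = 2 ^ (i + 1) := by
  rw [sub_add_eq_add_sub, add_sub_assoc,
    natDegree_add_eq_left_of_degree_lt (degree_one_sub_critOrbit_lt i), natDegree_critOrbit]

lemma misiurewiczRatFunc_two (m : ℕ) :
    misiurewiczRatFunc (m + 1) 2 =
      algebraMap ℂ[X] (RatFunc ℂ) (critOrbit (m + 1) - critOrbit m + 1) *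
        if 2 ∣ m then (algebraMap ℂ[X] (RatFunc ℂ) (X + 1))⁻¹ else 1 := by
  have hne {p : ℂ[X]} (hp : p.Monic) : algebraMap ℂ[X] (RatFunc ℂ) p ≠ 0 :=
    RatFunc.algebraMap_ne_zero hp.ne_zero
  have h1 := hne (monic_critOrbit_add m)
  have hX := hne monic_X
  have hX1 : algebraMap ℂ[X] (RatFunc ℂ) (X + 1) ≠ 0 := hne (monic_X_add_C (1 : ℂ))
  have hdiv : Nat.divisors 2 = {1, 2} := by decide
  have hmu : ArithmeticFunction.moebius 2 = -1 :=
    ArithmeticFunction.moebius_apply_prime Nat.prime_two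
  have h2 : critOrbit 2 = X * (X + 1) := by simp only [critOrbit]; ring
  simp only [misiurewiczRatFunc, hdiv]
  rw [Finset.prod_pair (by norm_num), Finset.prod_pair (by norm_num)]
  simp only [Nat.div_one, Nat.div_self two_pos, hmu, ArithmeticFunction.moebius_apply_one,
    Nat.add_sub_cancel, zpow_neg, zpow_one, neg_neg, critOrbit_one, h2]
  rw [show m + 1 + 2 - 1 = m + 2 from rfl, critOrbit_add_critOrbit, map_mul, map_mul]
  split_ifs <;> field_simp

lemma misiurewiczPoly_two_of_not_dvd {m : ℕ} (hm : ¬ 2 ∣ m) :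
    misiurewiczPoly (m + 1) 2 = critOrbit (m + 1) - critOrbit m + 1 := by
  rw [misiurewiczPoly, misiurewiczRatFunc_two, if_neg hm, mul_one, RatFunc.num_algebraMap]

lemma misiurewiczPoly_two_of_dvd {m : ℕ} (hm : 2 ∣ m) {G : ℂ[X]}
    (hG : critOrbit (m + 1) - critOrbit m + 1 = (X + 1) * G) :
    misiurewiczPoly (m + 1) 2 = G := by
  have hX1 : algebraMap ℂ[X] (RatFunc ℂ) (X + 1) ≠ 0 :=
    RatFunc.algebraMap_ne_zero (monic_X_add_C (1 : ℂ)).ne_zero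
  rw [misiurewiczPoly, misiurewiczRatFunc_two, if_pos hm, hG, map_mul, mul_right_comm,
    mul_inv_cancel₀ hX1, one_mul, RatFunc.num_algebraMap]

/-! ### From an annihilating integer polynomial to the multiplier polynomial. -/

lemma map_comp_eq_aeval (P : ℤ[X]) (u : ℂ[X]) :
    (P.map (Int.castRingHom ℂ)).comp u = aeval u P := by
  rw [comp, eval₂_map, aeval_def]
  congr 1

lemma roots_map_prod_eq_map {F u w : ℂ[X]} {Q : ℤ[X]} (hF : F.Monic) (hQ : Q.Monic)
    (hd : Q.natDegree = F.natDegree) (hu : F ∣ aeval u Q) (hw : F ∣ w.comp u - X) :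
    (F.roots.map fun c => X - C (u.eval c)).prod = Q.map (Int.castRingHom ℂ) := by
  have hs := IsAlgClosed.splits F
  have hprod : (F.roots.map fun c => X - C c).prod = F := (hs.eq_prod_roots_of_monic hF).symm
  refine prod_X_sub_C_eval_eq u w _ _ (hQ.map _) ?_ ?_ ?_
  · rw [hQ.natDegree_map, hd, hs.natDegree_eq_card_roots]
  · rwa [hprod, map_comp_eq_aeval]
  · rwa [hprod]

lemma multiplierPoly_eq_map {m n : ℕ} {u w : ℂ[X]} {Q : ℤ[X]}
    (hF : (misiurewiczPoly m n).Monic)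
    (hmul : ∀ c, (misiurewiczPoly m n).IsRoot c → cycleMultiplier m n c = u.eval c)
    (hQ : Q.Monic) (hd : Q.natDegree = (misiurewiczPoly m n).natDegree)
    (hu : misiurewiczPoly m n ∣ aeval u Q) (hw : misiurewiczPoly m n ∣ w.comp u - X) :
    Q.map (Int.castRingHom ℂ) = multiplierPoly m n := by
  rw [← roots_map_prod_eq_map hF hQ hd hu hw, multiplierPoly]
  congr 1
  refine Multiset.map_congr rfl fun c hc => ?_
  rw [hmul c (isRoot_of_mem_roots hc)]

/-- An extraneous root `a` with `u(a) = 0` contributes exactly the factor `X`, which is cancelled.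
It is used at `a = 0` for period 1 and at `a = -1` for period 2. -/
lemma multiplierPoly_eq_map_of_mul {m n : ℕ} {F u w : ℂ[X]} {a : ℂ} {Q : ℤ[X]} (hF : F.Monic)
    (hFG : F = (X - C a) * misiurewiczPoly m n) (ha : u.eval a = 0)
    (hmul : ∀ c, (misiurewiczPoly m n).IsRoot c → cycleMultiplier m n c = u.eval c)
    (hQ : (X * Q).Monic) (hd : (X * Q).natDegree = F.natDegree)
    (hu : F ∣ aeval u (X * Q)) (hw : F ∣ w.comp u - X) :
    Q.map (Int.castRingHom ℂ) = multiplierPoly m n := by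
  have h := roots_map_prod_eq_map hF hQ hd hu hw
  rw [hFG, roots_mul (hFG ▸ hF.ne_zero), roots_X_sub_C, Multiset.map_add, Multiset.prod_add,
    Multiset.map_singleton, Multiset.prod_singleton, ha, C_0, sub_zero, Polynomial.map_mul,
    map_X] at h
  rw [← mul_left_cancel₀ X_ne_zero h, multiplierPoly]
  congr 1
  refine Multiset.map_congr rfl fun c hc => ?_
  rw [hmul c (isRoot_of_mem_roots hc)]

/-! ### Fixed points -/

/-- The constant `N` in `2 y * E = N * (a - y)`; see `fixedOrbit`. -/
def fixedScale : ℕ → ℤ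
  | 0 => -4
  | i + 1 => fixedScale i ^ 2

/-- Up to the factor `fixedScale i`, the polynomial `(a_{i+1} - y) / (2 y)` in `2 y`, where `y` is a
fixed point of `z ^ 2 + c` and `c = y - y ^ 2`. -/
noncomputable def fixedOrbit : ℕ → ℤ[X]
  | 0 => X
  | i + 1 => X * fixedOrbit i ^ 2 + C (fixedScale i) * (X * fixedOrbit i)

lemma fixedScale_succ (i : ℕ) : fixedScale (i + 1) = 2 ^ 2 ^ (i + 2) := by
  induction i with
  | zero => norm_num [fixedScale]
  | succ i ih => rw [fixedScale, ih, ← pow_mul, ← pow_succ]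

lemma isSpecialForm_fixedOrbit (i : ℕ) :
    IsSpecialForm (i + 2) (2 ^ (i + 2) - 2) (fixedOrbit (i + 1)) := by
  induction i with
  | zero => exact ⟨0, by rw [degree_zero]; exact WithBot.bot_lt_coe _,
      by norm_num [fixedOrbit, fixedScale]; ring⟩
  | succ i ih =>
    have h4 : 4 ≤ 2 ^ (i + 2) := by
      calc 4 = 2 ^ 2 := rfl
        _ ≤ _ := Nat.pow_le_pow_right two_pos (by omega)
    have hlt : i + 1 < 2 ^ (i + 1) := Nat.lt_two_pow_self
    have hle : i + 2 + 1 + 1 ≤ 2 ^ (i + 2) := by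
      rw [show i + 2 = i + 1 + 1 from rfl, pow_succ 2 (i + 1)]; omega
    have he : 2 ^ (i + 1 + 2) - 2 = 2 * (2 ^ (i + 2) - 2) + 1 + 1 := by
      rw [show i + 1 + 2 = i + 2 + 1 from rfl, pow_succ]; omega
    rw [he, fixedOrbit]
    refine (ih.sq (by omega)).X_mul.add_C_mul ?_ ?_
    · rw [← natDegree_lt_iff_degree_lt (mul_ne_zero X_ne_zero ih.monic.ne_zero),
        ih.X_mul.natDegree_eq]
      omega
    · rw [fixedScale_succ]
      exact pow_dvd_pow _ hle

lemma isSpecialForm_fixedOrbit_add (i : ℕ) :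
    ∃ s, 2 ≤ s ∧ IsSpecialForm s (2 ^ (i + 1) - 2) (fixedOrbit i + C (fixedScale i)) := by
  rcases i with _ | i
  -- The polynomial is `X - 4`.
  · exact ⟨2, le_rfl, 0, by simp, by norm_num [fixedOrbit, fixedScale]; ring⟩
  · refine ⟨i + 2, by omega, ?_⟩
    have h4 : 4 ≤ 2 ^ (i + 2) := by
      calc 4 = 2 ^ 2 := rfl
        _ ≤ _ := Nat.pow_le_pow_right two_pos (by omega)
    have hlt : i + 2 < 2 ^ (i + 2) := Nat.lt_two_pow_self
    rw [← mul_one (C (fixedScale (i + 1)))]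
    refine (isSpecialForm_fixedOrbit i).add_C_mul ?_ ?_
    · rw [degree_one]
      exact_mod_cast (show 0 < 2 ^ (i + 2) - 2 by omega)
    · rw [fixedScale_succ]
      exact pow_dvd_pow _ (by omega)

/-- With `d = a_{i+1} - y` and `c = y - y²`, the next difference is `a_{i+1}² - y² = d(d + 2y)`.
Multiplying by `N²` gives the recursion of `fixedOrbit`. -/
lemma dvd_fixedOrbit_sub {H y : ℂ[X]} (hy : H ∣ y - y ^ 2 - X) (i : ℕ) :
    H ∣ 2 * y * aeval (2 * y) (fixedOrbit i) - (fixedScale i : ℂ[X]) * (critOrbit (i + 1) - y) := by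
  induction i with
  | zero =>
    obtain ⟨r, hr⟩ := hy
    refine ⟨-4 * r, ?_⟩
    simp only [fixedOrbit, fixedScale, aeval_X, zero_add, critOrbit_one]
    push_cast
    linear_combination -4 * hr
  | succ i ih =>
    obtain ⟨r, hr⟩ := hy
    obtain ⟨k, hk⟩ := ih
    simp only [fixedOrbit, fixedScale, map_add, map_mul, map_pow, aeval_X, eq_intCast,
      map_intCast, critOrbit_succ (i + 1), Int.cast_pow]
    set T := aeval (2 * y) (fixedOrbit i)
    set N : ℂ[X] := (fixedScale i : ℂ[X])
    set a := critOrbit (i + 1)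
    refine ⟨k * (2 * y * T + N * (a - y)) + N * (2 * y) * k + N ^ 2 * r, ?_⟩
    linear_combination (2 * y * T + N * (a - y) + N * (2 * y)) * hk + N ^ 2 * hr

lemma exists_multiplierPoly_one (i : ℕ) :
    ∃ P : ℤ[X], P.map (Int.castRingHom ℂ) = multiplierPoly (i + 2) 1 ∧ IsPSpecial 2 P := by
  obtain ⟨s, hs, hP⟩ := isSpecialForm_fixedOrbit_add i
  obtain ⟨G, hG⟩ : X ∣ critOrbit (i + 2) + critOrbit (i + 1) :=
    dvd_add (X_dvd_critOrbit _) (X_dvd_critOrbit _)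
  -- Modulo `a_{i+2} + a_{i+1}`, the point `y = a_{i+2}` is fixed: `y - y² - c = a_{i+1}² -
  -- a_{i+2}²`.
  have hH : critOrbit (i + 2) + critOrbit (i + 1) ∣
      critOrbit (i + 2) - critOrbit (i + 2) ^ 2 - X :=
    ⟨critOrbit (i + 1) - critOrbit (i + 2), by
      linear_combination critOrbit_succ (i + 1)⟩
  have hGm := misiurewiczPoly_one (m := i + 2) hG
  refine ⟨_, ?_, hP.isPSpecial hs⟩
  -- The left inverse `w` is `c = y - y²` written in `x = 2y`.
  refine multiplierPoly_eq_map_of_mul (F := critOrbit (i + 2) + critOrbit (i + 1))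
    (u := 2 * critOrbit (i + 2)) (w := C (1 / 2) * X - C (1 / 4) * X ^ 2) (a := 0)
    (monic_critOrbit_add _) ?_ ?_ ?_ hP.X_mul.monic ?_ ?_ ?_
  · rw [hGm, hG, C_0, sub_zero]
  · obtain ⟨q, hq⟩ := X_dvd_critOrbit (i + 2)
    simp [hq]
  · intro c _
    rw [cycleMultiplier_one]
    simp
  · rw [hP.X_mul.natDegree_eq, natDegree_critOrbit_add]
    have : 2 ≤ 2 ^ (i + 1) := Nat.le_self_pow (by omega) 2
    omega
  -- Adding `2y * N` turns `N * (a_{i+1} - y)` into `N * (a_{i+1} + y)`, which is `N * F` for `y =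
  -- a_{i+2}`.
  · obtain ⟨k, hk⟩ := dvd_fixedOrbit_sub hH i
    refine ⟨k + (fixedScale i : ℂ[X]), ?_⟩
    simp only [map_add, map_mul, aeval_X, eq_intCast, map_intCast]
    linear_combination hk
  · convert hH using 1
    have h2 : (C (1 / 2) * 2 : ℂ[X]) = 1 := by
      rw [← C_ofNat, ← C_mul]; norm_num
    have h4 : (C (1 / 4) * 4 : ℂ[X]) = 1 := by
      rw [← C_ofNat, ← C_mul]; norm_num
    simp only [sub_comp, mul_comp, C_comp, X_comp, pow_comp]
    linear_combination critOrbit (i + 2) * h2 - critOrbit (i + 2) ^ 2 * h4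

/-! ### Cycles of length two -/

/-- The polynomial `a_{i+1}` in terms of the multiplier `4 * (c + 1)`, scaled to be monic. -/
noncomputable def scaledOrbit : ℕ → ℤ[X]
  | 0 => X - C 4
  | i + 1 => scaledOrbit i ^ 2 + C (4 ^ (2 ^ (i + 1) - 1)) * (X - C 4)

/-- The polynomial `a_{i+2} - a_{i+1} + 1` in terms of the multiplier `4 * (c + 1)`, scaled to be
monic. -/
noncomputable def scaledOrbitSub (i : ℕ) : ℤ[X] :=
  scaledOrbit (i + 1) + C (4 ^ 2 ^ i) * (C (4 ^ 2 ^ i) - scaledOrbit i)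

lemma isSpecialForm_scaledOrbit (i : ℕ) :
    IsSpecialForm (i + 2) (2 ^ (i + 1) - 1) (scaledOrbit (i + 1)) := by
  induction i with
  | zero => exact ⟨0, by simp, by norm_num [scaledOrbit]; ring⟩
  | succ i ih =>
    have hlt : i + 1 < 2 ^ (i + 1) := Nat.lt_two_pow_self
    have he : 2 ^ (i + 1 + 1) - 1 = 2 * (2 ^ (i + 1) - 1) + 1 := by
      rw [pow_succ]; omega
    rw [he, scaledOrbit]
    refine (ih.sq (by omega)).add_C_mul ?_ ?_
    · rw [degree_X_sub_C]
      exact_mod_cast (by omega : 1 < 2 * (2 ^ (i + 1) - 1) + 1)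
    · rw [show (4 : ℤ) = 2 ^ 2 from rfl, ← pow_mul, pow_succ 2 (i + 1)]
      exact pow_dvd_pow _ (by omega)

lemma isSpecialForm_scaledOrbitSub (i : ℕ) :
    ∃ s, 2 ≤ s ∧ IsSpecialForm s (2 ^ (i + 1) - 1) (scaledOrbitSub i) := by
  rcases i with _ | i
  -- Here `X² - 8X + 32`: for `i = 0` the correction is too large to be absorbed and changes `s`
  -- from 2 to 3.
  · refine ⟨3, by omega, 2, ?_, ?_⟩
    · rw [← C_ofNat, degree_C two_ne_zero]; norm_num
    · norm_num [scaledOrbitSub, scaledOrbit]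
      simp only [← C_ofNat]
      norm_num
      ring
  · refine ⟨i + 3, by omega, ?_⟩
    have hlt : i + 1 < 2 ^ (i + 1) := Nat.lt_two_pow_self
    have hi := isSpecialForm_scaledOrbit i
    have hs : 2 ^ (i + 1 + 1) = 2 * 2 ^ (i + 1) := pow_succ' _ _
    refine (isSpecialForm_scaledOrbit (i + 1)).add_C_mul ?_ ?_
    · refine lt_of_le_of_lt (degree_sub_le _ _) (max_lt ?_ ?_)
      · refine degree_C_le.trans_lt ?_
        exact_mod_cast (by omega : 0 < 2 ^ (i + 1 + 1) - 1)
      · rw [← natDegree_lt_iff_degree_lt hi.monic.ne_zero, hi.natDegree_eq]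
        omega
    · rw [show (4 : ℤ) = 2 ^ 2 from rfl, ← pow_mul]
      exact pow_dvd_pow _ (by omega)

/-- Under the substitution `X - 4` becomes `4c`, supplying the factor 4 missing from the exponent `2
^ (i + 1) - 1` in the recursion. -/
lemma aeval_scaledOrbit (i : ℕ) :
    aeval (4 * (X + 1) : ℂ[X]) (scaledOrbit i) = 4 ^ 2 ^ i * critOrbit (i + 1) := by
  induction i with
  | zero =>
    simp only [scaledOrbit, map_sub, aeval_X, zero_add, critOrbit_one, map_ofNat]
    ring
  | succ i ih =>
    obtain ⟨k, hk⟩ : ∃ k, 2 ^ (i + 1) = k + 1 := Nat.exists_eq_succ_of_ne_zero (by positivity)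
    have h2 : ((4 : ℂ[X]) ^ 2 ^ i) ^ 2 = 4 ^ (k + 1) := by rw [← pow_mul, ← pow_succ, hk]
    simp only [scaledOrbit, map_add, map_mul, map_pow, map_sub, aeval_X, ih, hk,
      critOrbit_succ (i + 1), Nat.add_sub_cancel, map_ofNat]
    linear_combination critOrbit (i + 1) ^ 2 * h2

lemma aeval_scaledOrbitSub (i : ℕ) :
    aeval (4 * (X + 1) : ℂ[X]) (scaledOrbitSub i) =
      4 ^ 2 ^ (i + 1) * (critOrbit (i + 2) - critOrbit (i + 1) + 1) := by
  simp only [scaledOrbitSub, map_add, map_mul, map_pow, map_sub, aeval_scaledOrbit, map_ofNat]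
  ring

/-- For `c = -1` the critical point itself has period 2; this parameter is the root of the factor `X
+ 1` to be removed when `2 ∣ m - 1`. -/
lemma critOrbit_eval_neg_one (k : ℕ) :
    (critOrbit (2 * k)).eval (-1) = 0 ∧ (critOrbit (2 * k + 1)).eval (-1) = -1 := by
  induction k with
  | zero => simp [critOrbit]
  | succ k ih =>
    rw [show 2 * (k + 1) = 2 * k + 1 + 1 from rfl, critOrbit_succ (2 * k + 1 + 1),
      critOrbit_succ (2 * k + 1)]
    simp [ih.2]

/-- Put `a = a_{m+1}`. Substituting `a_m = a + 1` in `a = a_m² + c` gives `a² + a + c + 1 = 0`, so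
the other point of the cycle is `-1 - a` and the product of the two is `c + 1`. -/
lemma cycleMultiplier_two_of_isRoot {m : ℕ} {c : ℂ}
    (hc : (critOrbit (m + 1) - critOrbit m + 1).eval c = 0) :
    cycleMultiplier (m + 1) 2 c = 4 * (c + 1) := by
  have h := congrArg (eval c) (critOrbit_succ m)
  rw [cycleMultiplier_two, critOrbit_succ (m + 1)]
  simp only [eval_add, eval_sub, eval_pow, eval_X, eval_one] at hc h ⊢
  set a := (critOrbit (m + 1)).eval c
  linear_combination 4 * (a - 1) * (-h + (a + 1 + (critOrbit m).eval c) * hc)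

lemma exists_multiplierPoly_two (i : ℕ) :
    ∃ P : ℤ[X], P.map (Int.castRingHom ℂ) = multiplierPoly (i + 2) 2 ∧ IsPSpecial 2 P := by
  obtain ⟨s, hs, hP⟩ := isSpecialForm_scaledOrbitSub i
  have hpos : i + 1 < 2 ^ (i + 1) := Nat.lt_two_pow_self
  have hdeg : (scaledOrbitSub i).natDegree =
      (critOrbit (i + 2) - critOrbit (i + 1) + 1).natDegree := by
    rw [hP.natDegree_eq, natDegree_critOrbit_sub]
    omega
  have hu := Dvd.intro_left _ (aeval_scaledOrbitSub i).symm
  have hw : (C (1 / 4) * X - 1 : ℂ[X]).comp (4 * (X + 1)) - X = 0 := by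
    have h4 : (C (1 / 4) * 4 : ℂ[X]) = 1 := by
      rw [← C_ofNat, ← C_mul]; norm_num
    simp only [sub_comp, mul_comp, C_comp, X_comp, one_comp]
    linear_combination (X + 1) * h4
  by_cases h2 : 2 ∣ i + 1
  · obtain ⟨k, hk⟩ := h2
    have hroot : (critOrbit (i + 2) - critOrbit (i + 1) + 1).eval (-1) = 0 := by
      obtain ⟨h0, h1⟩ := critOrbit_eval_neg_one k
      rw [show i + 2 = 2 * k + 1 by omega, hk, eval_add, eval_sub, h0, h1, eval_one]
      norm_num
    obtain ⟨G, hG⟩ := dvd_iff_isRoot.2 hroot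
    have hGm := misiurewiczPoly_two_of_dvd ⟨k, hk⟩ (by simpa using hG)
    -- The extraneous root `c = -1` has `4(c + 1) = 0`, so it appears as a root at 0.
    have h0 : (scaledOrbitSub i).coeff 0 = 0 := by
      have h := congrArg (eval (-1)) (aeval_scaledOrbitSub i)
      rw [eval_mul, hroot, mul_zero, ← map_comp_eq_aeval, eval_comp] at h
      rw [coeff_zero_eq_eval_zero]
      have hz : eval (-1) (4 * (X + 1) : ℂ[X]) = ((0 : ℤ) : ℂ) := by simp
      rw [hz, eval_intCast_map, eq_intCast] at h
      exact_mod_cast h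
    obtain ⟨P, hXP⟩ := X_dvd_iff.2 h0
    obtain ⟨e, he⟩ : ∃ e, 2 ^ (i + 1) - 1 = e + 2 := ⟨_, (Nat.sub_add_cancel (by
      have : 2 ^ 2 ≤ 2 ^ (i + 1) := Nat.pow_le_pow_right two_pos (by omega)
      omega)).symm⟩
    rw [he, hXP] at hP
    rw [hXP] at hu hdeg
    refine ⟨P, ?_, hP.of_X_mul.isPSpecial hs⟩
    refine multiplierPoly_eq_map_of_mul (monic_critOrbit_sub i) (hGm ▸ hG) (by simp) ?_ hP.monic
      hdeg hu (hw ▸ dvd_zero _)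
    intro c hc
    rw [hGm] at hc
    rw [cycleMultiplier_two_of_isRoot]
    · simp
    · rw [hG, eval_mul, hc.eq_zero, mul_zero]
  · have hGm := misiurewiczPoly_two_of_not_dvd h2
    refine ⟨_, ?_, hP.isPSpecial hs⟩
    refine multiplierPoly_eq_map (u := 4 * (X + 1)) (w := C (1 / 4) * X - 1) ?_ ?_ hP.monic ?_ ?_
      (hw ▸ dvd_zero _)
    · exact hGm ▸ monic_critOrbit_sub i
    · intro c hc
      rw [hGm] at hc
      rw [cycleMultiplier_two_of_isRoot hc]
      simp
    · rw [hGm, hdeg]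
    · exact hGm ▸ hu

theorem theorem7p2 (m : ℕ) (hm : 2 ≤ m) :
    (∃ P : ℤ[X], P.map (Int.castRingHom ℂ) = multiplierPoly m 1 ∧ IsPSpecial 2 P) ∧
    (∃ P : ℤ[X], P.map (Int.castRingHom ℂ) = multiplierPoly m 2 ∧ IsPSpecial 2 P) := by
  obtain ⟨i, rfl⟩ := Nat.exists_eq_add_of_le' hm
  exact ⟨exists_multiplierPoly_one i, exists_multiplierPoly_two i⟩
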